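/- Let $k$ be a field, $H$ a group, $A,B\le H$ subgroups, $\varphi:A\to B$ an isomorphism, and $G=\mathrm{gp}\langle H,t\mid t^{-1}at=\varphi(a),\ a\in A\rangle$ the HNN-extension. Choose a set $T_{-1}$ of representatives of the right cosets $Ah$ and a set $T_{1}$ of representatives of the right cosets $Bh$ in $H$, both containing $1$, and a well order $\prec$ on $H$. Let $X=(H\setminus\{1\})\cup\{t,t^{-1}\}$; an element of $H$ is read as a word of length one over $X$, and $1\in H$ as the empty word. Let $S\subset k\langle X\rangle$ consist of $$g\cdot h-(gh)\ \ (g,h\in H\setminus\{1\}),\qquad t^{-1}\cdot(ar)-\varphi(a)\cdot t^{-1}\cdot r\ \ (1\ne a\in A,\ r\in T_{-1}),$$ $$t\cdot(br)-\varphi^{-1}(b)\cdot t\cdot r\ \ (1\ne b\in B,\ r\in T_{1}),\qquad t^{\varepsilon}\cdot t^{-\varepsilon}-1\ \ (\varepsilon=\pm1),$$ where $(gh)$, $(ar)$, $(br)$ are products in $H$. Order $X^*$ as follows. Write words as $u=u_0t^{\varepsilon_1}u_1\cdots t^{\varepsilon_n}u_n$ with $u_i\in (H\setminus\{1\})^*$.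 Compare two words first by $n$; then lexicographically from right to left by the pairs $(\varepsilon_i,u_i)$, $i=n,\dots,1$, where pairs are compared first by $\varepsilon_i$ (with $-1<1$) and then $u_i$ by the deg-lex order built on the well order $\prec_{\varepsilon_i}$ of $H\setminus\{1\}$ in which the elements of $T_{\varepsilon_i}$ precede all others and which otherwise agrees with $\prec$; finally by $u_0$ in the deg-lex order built on $\prec$. For nonzero $f\in k\langle X\rangle$ let $\bar f$ be its leading word. Then: 1. This order $<$ is an $S$-weak monomial order, that is: it is a well order; $\overline{asb}=a\bar sb$ for all $s\in S$, $a,b\in X^*$; and each composition $(s_1,s_2)_w$ of elements of $S$ can be written as a finite sum $\sum_i\alpha_ia_it_ib_i$ with $\alpha_i\in k$, $a_i,b_i\in X^*$, $t_i\in S$, such that $a_i\bar t_ib_i<w$ and $ca_i\bar t_ib_id<cwd$ for all $c,d\in X^*$. Here a composition of monic $f,g$ is $fb-ag$ when $w=\bar fb=a\bar g$ with $|w|<|\bar f|+|\bar g|$, or $f-agb$ when $w=\bar f=a\bar gb$ ($a,b\in X^*$). 2. $S$ is a Gröbner–Shirshov basis of $G$: its elements are monic, each composition $(f,g)_w$ of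 elements of $S$ is a finite sum $\sum_i\alpha_ia_is_ib_i$ with $s_i\in S$ and $\overline{a_is_ib_i}<w$, and the natural map $k\langle X\rangle\to k[G]$ is surjective with kernel the two-sided ideal generated by $S$. 3. The set $\mathrm{Irr}(S)=\{u\in X^*\mid u\ne a\bar sb,\ s\in S,\ a,b\in X^*\}$ coincides with the set of normal forms of the Normal Form Theorem for HNN-extensions, i.e. of the words $g_0t^{\varepsilon_1}g_1\cdots t^{\varepsilon_n}g_n$ ($n\ge0$, $\varepsilon_i=\pm1$) with $g_0\in H$ arbitrary, $g_i\in T_{\varepsilon_i}$ for $i\ge1$, and no consecutive $t^{\varepsilon},1,t^{-\varepsilon}$; and each element of $G$ is represented by exactly one word in $\mathrm{Irr}(S)$. -/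

import Mathlib

/-! ### Gröbner–Shirshov bases in the free associative algebra

The free associative algebra `k⟨X⟩` is the monoid algebra of the free monoid `X*`.  Throughout `lt`
is the strict order on words. -/

namespace GroebnerShirshov

/-- The free associative algebra `k⟨X⟩`. -/
abbrev FreeAlg (k X : Type*) [Field k] : Type _ := MonoidAlgebra k (FreeMonoid X)

/-- The word `w`, seen as an element of `k⟨X⟩`. -/
noncomputable def mono (k : Type*) {X : Type*} [Field k] (w : FreeMonoid X) : FreeAlg k X :=
  MonoidAlgebra.single w 1

section

variable {k X : Type*} [Field k]

/-- `w` is the leading word of `f`: the largest word that occurs in `f`. -/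
def IsLeadingWord (lt : FreeMonoid X → FreeMonoid X → Prop) (f : FreeAlg k X)
    (w : FreeMonoid X) : Prop :=
  f.coeff w ≠ 0 ∧ ∀ v, f.coeff v ≠ 0 → v ≠ w → lt v w

/-- The leading coefficient of `f` is `1`. -/
def IsMonic (lt : FreeMonoid X → FreeMonoid X → Prop) (f : FreeAlg k X) : Prop :=
  ∃ w, IsLeadingWord lt f w ∧ f.coeff w = 1

/-- `IsComposition lt f g w p`: the polynomial `p` is a composition `(f, g)_w`. -/
inductive IsComposition (lt : FreeMonoid X → FreeMonoid X → Prop) (f g : FreeAlg k X)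
    (w : FreeMonoid X) : FreeAlg k X → Prop
  | intersection (u v a b : FreeMonoid X) (hf : IsLeadingWord lt f u) (hg : IsLeadingWord lt g v)
      (hl : w = u * b) (hr : w = a * v) (hdeg : w.length < u.length + v.length) :
      IsComposition lt f g w (f * mono k b - mono k a * g)
  | inclusion (v a b : FreeMonoid X) (hf : IsLeadingWord lt f w) (hg : IsLeadingWord lt g v)
      (hw : w = a * v * b) :
      IsComposition lt f g w (f - mono k a * g * mono k b)

/-- `p` is trivial modulo `(S, w)`: it is a finite sum of `αᵢ aᵢ sᵢ bᵢ` with `sᵢ ∈ S` and the leading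
word of each `aᵢ sᵢ bᵢ` smaller than `w`. -/
def IsTrivialMod (lt : FreeMonoid X → FreeMonoid X → Prop) (S : Set (FreeAlg k X))
    (w : FreeMonoid X) (p : FreeAlg k X) : Prop :=
  ∃ (n : ℕ) (α : Fin n → k) (a b : Fin n → FreeMonoid X) (s : Fin n → FreeAlg k X),
    p = ∑ i, α i • (mono k (a i) * s i * mono k (b i)) ∧
    ∀ i, s i ∈ S ∧ ∃ u, IsLeadingWord lt (mono k (a i) * s i * mono k (b i)) u ∧ lt u w

/-- `S` is a Gröbner–Shirshov basis in `k⟨X⟩` with respect to the well order `lt`. -/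
def IsGSBasis (lt : FreeMonoid X → FreeMonoid X → Prop) (S : Set (FreeAlg k X)) : Prop :=
  IsWellOrder (FreeMonoid X) lt ∧ (∀ s ∈ S, IsMonic lt s) ∧
    ∀ f ∈ S, ∀ g ∈ S, ∀ w p, IsComposition lt f g w p → IsTrivialMod lt S w p

/-- `lt` is an `S`-weak monomial order. -/
def IsWeakMonomialOrder (lt : FreeMonoid X → FreeMonoid X → Prop) (S : Set (FreeAlg k X)) :
    Prop :=
  IsWellOrder (FreeMonoid X) lt ∧
  (∀ s ∈ S, ∀ u, IsLeadingWord lt s u → ∀ a b : FreeMonoid X,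
    IsLeadingWord lt (mono k a * s * mono k b) (a * u * b)) ∧
  (∀ f ∈ S, ∀ g ∈ S, ∀ w p, IsComposition lt f g w p →
    ∃ (n : ℕ) (α : Fin n → k) (a b : Fin n → FreeMonoid X) (s : Fin n → FreeAlg k X)
      (u : Fin n → FreeMonoid X),
      p = ∑ i, α i • (mono k (a i) * s i * mono k (b i)) ∧
      ∀ i, s i ∈ S ∧ IsLeadingWord lt (s i) (u i) ∧ lt (a i * u i * b i) w ∧
        ∀ c d : FreeMonoid X, lt (c * (a i * u i * b i) * d) (c * w * d))

/-- The set of `S`-irreducible words: those without a subword that is the leading word of an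
element of `S`. -/
def Irr (lt : FreeMonoid X → FreeMonoid X → Prop) (S : Set (FreeAlg k X)) : Set (FreeMonoid X) :=
  {w | ∀ s ∈ S, ∀ u, IsLeadingWord lt s u → ∀ a b : FreeMonoid X, w ≠ a * u * b}

end

end GroebnerShirshov

/-! ### HNN-extensions -/

namespace HNNGSB

open GroebnerShirshov HNNExtension HNNExtension.NormalWord

/-- The HNN-extension `gp⟨H, t | t⁻¹ a t = φ(a), a ∈ A⟩`.  Mathlib's `HNNExtension G A B φ` has
the relations `t a = φ(a) t`, so that this group is obtained from `φ⁻¹ : B → A`; see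
`inv_t_mul_of_mul_t`. -/
abbrev HNN {H : Type*} [Group H] {A B : Subgroup H} (φ : A ≃* B) : Type _ :=
  HNNExtension H B A φ.symm

theorem inv_t_mul_of_mul_t {H : Type*} [Group H] {A B : Subgroup H} (φ : A ≃* B) (a : A) :
    (t⁻¹ * of (a : H) * t : HNN φ) = of (φ a : H) := by
  rw [inv_t_mul_of]; simp

/-- The alphabet `X = (H \ {1}) ∪ {t, t⁻¹}`; `stable 1` is `t` and `stable (-1)` is `t⁻¹`. -/
inductive Letter (H : Type*) [Group H] : Type _
  | base (h : {h : H // h ≠ 1}) : Letter H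
  | stable (ε : ℤˣ) : Letter H

section

variable {H : Type*} [Group H]

open Classical in
/-- An element of `H` as a word: one letter, or the empty word for `1`. -/
noncomputable def hWord (h : H) : FreeMonoid (Letter H) :=
  if hh : h = 1 then 1 else FreeMonoid.of (Letter.base ⟨h, hh⟩)

/-- The one-letter word `t ^ ε`. -/
def tWord (ε : ℤˣ) : FreeMonoid (Letter H) := FreeMonoid.of (Letter.stable ε)

/-- The element of the HNN-extension that a word represents. -/
def eval {A B : Subgroup H} (φ : A ≃* B) : FreeMonoid (Letter H) →* HNN φ :=
  FreeMonoid.lift fun x => match x with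
    | .base h => of h.1
    | .stable ε => t ^ (ε : ℤ)

/-- The induced homomorphism `k⟨X⟩ → k[G]` onto the group algebra of the HNN-extension. -/
noncomputable def evalAlg (k : Type*) [Field k] {A B : Subgroup H} (φ : A ≃* B) :
    FreeAlg k (Letter H) →ₐ[k] MonoidAlgebra k (HNN φ) :=
  MonoidAlgebra.mapDomainAlgHom k k (eval φ)

/-- The elements of the Gröbner–Shirshov basis.  Here `d.set 1` is a system of
representatives of the right cosets of `B` and `d.set (-1)` of those of `A`. -/
inductive Relator (k : Type*) [Field k] {A B : Subgroup H} (φ : A ≃* B)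
    (d : TransversalPair H B A) : FreeAlg k (Letter H) → Prop
  | mul (g h : H) (hg : g ≠ 1) (hh : h ≠ 1) :
      Relator k φ d (mono k (hWord g * hWord h) - mono k (hWord (g * h)))
  | pushA (a : A) (r : H) (ha : a ≠ 1) (hr : r ∈ d.set (-1)) :
      Relator k φ d (mono k (tWord (-1) * hWord (a * r))
        - mono k (hWord (φ a : H) * tWord (-1) * hWord r))
  | pushB (b : B) (r : H) (hb : b ≠ 1) (hr : r ∈ d.set 1) :
      Relator k φ d (mono k (tWord 1 * hWord (b * r))
        - mono k (hWord (φ.symm b : H) * tWord 1 * hWord r))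
  | cancel (ε : ℤˣ) : Relator k φ d (mono k (tWord ε * tWord (-ε)) - mono k 1)

/-- The Gröbner–Shirshov basis `S` of the HNN-extension. -/
def basis (k : Type*) [Field k] {A B : Subgroup H} (φ : A ≃* B) (d : TransversalPair H B A) :
    Set (FreeAlg k (Letter H)) :=
  {f | Relator k φ d f}

/-- A word `u₀ t^ε₁ u₁ ⋯ t^εₙ uₙ`, with words `uᵢ` over `H \ {1}`, is split into `u₀` and the
list of the pairs `(εᵢ, uᵢ)`. -/
def split : List (Letter H) → List {h : H // h ≠ 1} × List (ℤˣ × List {h : H // h ≠ 1})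
  | [] => ([], [])
  | .base h :: w => (h :: (split w).1, (split w).2)
  | .stable ε :: w => ([], (ε, (split w).1) :: (split w).2)

/-- The well order `lt` on `H`, changed so that the coset representatives in `d.set ε` come before
all other elements. -/
def cosetLt (lt : H → H → Prop) {A B : Subgroup H} (d : TransversalPair H B A) (ε : ℤˣ)
    (g h : {h : H // h ≠ 1}) : Prop :=
  (g.1 ∈ d.set ε ∧ h.1 ∉ d.set ε) ∨ ((g.1 ∈ d.set ε ↔ h.1 ∈ d.set ε) ∧ lt g.1 h.1)

/-- The order on the pairs `(ε, u)`: first by `ε`, then by the deg-lex order on words over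
`H \ {1}` that belongs to `ε`. -/
def pairLt (lt : H → H → Prop) {A B : Subgroup H} (d : TransversalPair H B A)
    (p q : ℤˣ × List {h : H // h ≠ 1}) : Prop :=
  p.1 < q.1 ∨ (p.1 = q.1 ∧ List.Shortlex (cosetLt lt d p.1) p.2 q.2)

/-- The order on words: `u₀ t^ε₁ u₁ ⋯ t^εₙ uₙ` and `v₀ t^δ₁ v₁ ⋯ t^δₘ vₘ` are compared
first by `n` and `m`, then lexicographically from right to left by the pairs `(εᵢ, uᵢ)` and
`(δᵢ, vᵢ)`, and then by the deg-lex order on `u₀` and `v₀`. -/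
def wordLt (lt : H → H → Prop) {A B : Subgroup H} (d : TransversalPair H B A)
    (u v : FreeMonoid (Letter H)) : Prop :=
  List.Shortlex (pairLt lt d) (split u.toList).2.reverse (split v.toList).2.reverse ∨
    ((split u.toList).2 = (split v.toList).2 ∧
      List.Shortlex (fun g h : {h : H // h ≠ 1} => lt g.1 h.1)
        (split u.toList).1 (split v.toList).1)

/-- The word `g₀ t^ε₁ g₁ ⋯ t^εₙ gₙ` that spells out a normal form `g₀, t^ε₁, g₁, …, t^εₙ, gₙ`. -/
noncomputable def spell {A B : Subgroup H} {d : TransversalPair H B A} (w : NormalWord d) :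
    FreeMonoid (Letter H) :=
  hWord w.head * (w.toList.map fun x => tWord x.1 * hWord x.2).prod

end

end HNNGSB

namespace HNNGSB

open GroebnerShirshov HNNExtension HNNExtension.NormalWord

/-! ### Cutting words at the stable letters -/

section Split

variable {H : Type*} [Group H]

/-! Every element of `S` is a binomial whose leading word has two letters, so `S` is a rewriting
system `xy → v`. Two relators compose only on a word `xyz`, or on a common `xy`, where the
composition is zero. The overlaps are `g h l`, `t^ε g l`, `t^(-δ) t^δ g` and `t^ε t^(-ε) t^ε`;
`Rule.confluent` resolves them by associativity in `H`, multiplicativity of `φ` and the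
factorization of elements into subgroup part and representative.

The order need not be monomial: how two base letters compare depends on the stable letter to their
left. It suffices that every rule lowers words in every context (`CtxLt`, `Rule.ctxLt`). Either
stable letters disappear, or a base segment gets shorter, or the rightmost pair that changes has a
non-representative replaced by a representative; in the last case whatever happens further left is
irrelevant.

Irreducibility is a condition on adjacent letters, and the words that satisfy it are the spelled
normal forms. That each group element has exactly one is the Normal Form Theorem
(`NormalWord.equiv`, `prod_injective`), not a consequence of confluence. Together with termination
of the rewriting it gives the kernel. -/

theorem split_append_stable (l w : List (Letter H)) (ε : ℤˣ) :
    split (l ++ .stable ε :: w) =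
      ((split l).1, (split l).2 ++ (ε, (split w).1) :: (split w).2) := by
  induction l with
  | nil => simp [split]
  | cons x l ih => cases x <;> simp [split, ih]

theorem split_map_base_append (x : List {h : H // h ≠ 1}) (w : List (Letter H)) :
    split (x.map .base ++ w) = (x ++ (split w).1, (split w).2) := by
  induction x with
  | nil => simp
  | cons a x ih => simp [split, ih]

theorem length_split_append (l w : List (Letter H)) :
    (split (l ++ w)).2.length = (split l).2.length + (split w).2.length := by
  induction l with
  | nil => simp [split]
  | cons x l ih => cases x <;> simp [split, ih]; omega

/-- The number of letters `t` and `t⁻¹` in a word. -/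
def stableCount (u : FreeMonoid (Letter H)) : ℕ := (split u.toList).2.length

@[simp]
theorem stableCount_mul (u v : FreeMonoid (Letter H)) :
    stableCount (u * v) = stableCount u + stableCount v := by
  simp [stableCount, FreeMonoid.toList_mul, length_split_append]

@[simp]
theorem stableCount_one : stableCount (1 : FreeMonoid (Letter H)) = 0 := rfl

@[simp]
theorem stableCount_tWord (ε : ℤˣ) : stableCount (tWord ε : FreeMonoid (Letter H)) = 1 := rfl

@[simp]
theorem stableCount_hWord (g : H) : stableCount (hWord g) = 0 := by
  unfold hWord
  split_ifs <;> rfl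

/-- A word over `H \ {1}`, as a word over the alphabet. -/
def baseWord (x : List {h : H // h ≠ 1}) : FreeMonoid (Letter H) :=
  FreeMonoid.ofList (x.map .base)

theorem hWord_of_ne_one {g : H} (hg : g ≠ 1) :
    hWord g = FreeMonoid.of (Letter.base ⟨g, hg⟩) :=
  dif_neg hg

@[simp]
theorem hWord_one : hWord (1 : H) = 1 := dif_pos rfl

theorem exists_hWord_eq_baseWord (g : H) :
    ∃ x : List {h : H // h ≠ 1}, hWord g = baseWord x ∧ x.length ≤ 1 := by
  by_cases hg : g = 1
  · exact ⟨[], by simp [hg, baseWord], by simp⟩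
  · exact ⟨[⟨g, hg⟩], hWord_of_ne_one hg, le_rfl⟩

theorem eq_map_base_or_eq_append_stable (l : List (Letter H)) :
    (∃ x : List {h : H // h ≠ 1}, l = x.map .base) ∨
      ∃ (l' : List (Letter H)) (ε : ℤˣ) (x : List {h : H // h ≠ 1}),
        l = l' ++ .stable ε :: x.map .base := by
  induction l with
  | nil => exact .inl ⟨[], rfl⟩
  | cons a l ih =>
    rcases ih with ⟨x, rfl⟩ | ⟨l', ε, x, rfl⟩
    · cases a with
      | base h => exact .inl ⟨h :: x, rfl⟩
      | stable ε => exact .inr ⟨[], ε, x, rfl⟩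
    · exact .inr ⟨a :: l', ε, x, rfl⟩

/-- Needed for trichotomy of `wordLt`, which sees a word only through `split`. -/
theorem split_injective : Function.Injective (split (H := H)) := by
  intro l
  induction l with
  | nil =>
    rintro (_ | ⟨_ | _, w⟩) h <;> simp_all [split]
  | cons x l ih =>
    intro w h
    cases x <;> rcases w with _ | ⟨_ | _, w⟩ <;> simp [split] at h ⊢
    · exact ⟨h.1.1, ih (Prod.ext h.1.2 h.2)⟩
    · exact ⟨h.1.1, ih (Prod.ext h.1.2 h.2)⟩

end Split

/-! ### The well order on words and comparison in all contexts -/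

section Order

variable {H : Type*} [Group H] {A B : Subgroup H} (lt : H → H → Prop) (d : TransversalPair H B A)

-- Tagging representatives with 0 and other elements with 1 turns the modified order into a
-- pulled-back lexicographic product, so it inherits well-foundedness.
open Classical in
theorem cosetLt_eq_invImage (ε : ℤˣ) :
    cosetLt lt d ε = InvImage (Prod.Lex (· < ·) lt)
      (fun h : {h : H // h ≠ 1} => ((if h.1 ∈ d.set ε then 0 else 1 : ℕ), h.1)) := by
  ext g h
  by_cases hg : g.1 ∈ d.set ε <;> by_cases hh : h.1 ∈ d.set ε <;>
    simp [cosetLt, InvImage, Prod.lex_def, hg, hh]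

instance isWellOrder_cosetLt [IsWellOrder H lt] (ε : ℤˣ) :
    IsWellOrder {h : H // h ≠ 1} (cosetLt lt d ε) := by
  rw [cosetLt_eq_invImage]
  exact
    { wf := InvImage.wf _ IsWellFounded.wf
      trichotomous := (InvImage.trichotomous fun g h e => Subtype.ext (Prod.ext_iff.1 e).2).1 }

instance isWellOrder_shortlex {α : Type*} (r : α → α → Prop) [IsWellOrder α r] :
    IsWellOrder (List α) (List.Shortlex r) where
  wf := List.Shortlex.wf IsWellFounded.wf
  trichotomous := List.Shortlex.trichotomous.1

instance isWellOrder_pairLt [IsWellOrder H lt] :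
    IsWellOrder (ℤˣ × List {h : H // h ≠ 1}) (pairLt lt d) where
  wf := by
    -- The order on the second component varies with `ε`, so the lexicographic product is a
    -- dependent one.
    have h := WellFounded.psigma_lex (r := ((· < ·) : ℤˣ → ℤˣ → Prop))
      (s := fun ε => List.Shortlex (cosetLt lt d ε)) wellFounded_lt
      fun ε => (isWellOrder_shortlex (cosetLt lt d ε)).wf
    refine Subrelation.wf ?_ (InvImage.wf (fun p => ⟨p.1, p.2⟩) h)
    rintro ⟨ε, x⟩ ⟨δ, y⟩ (hp | ⟨rfl : ε = δ, hp⟩)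
    · exact .left _ _ hp
    · exact .right _ hp
  trichotomous := by
    rintro ⟨ε, x⟩ ⟨δ, y⟩ h₁ h₂
    simp only [pairLt, not_or, not_and] at h₁ h₂
    have he : ε = δ := le_antisymm (not_lt.1 h₂.1) (not_lt.1 h₁.1)
    subst he
    have := (isWellOrder_shortlex (cosetLt lt d ε)).trichotomous x y (h₁.2 rfl) (h₂.2 rfl)
    rw [this]

instance isWellOrder_letterLt [IsWellOrder H lt] :
    IsWellOrder {h : H // h ≠ 1} (fun g h => lt g.1 h.1) where
  wf := InvImage.wf _ IsWellFounded.wf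
  trichotomous := (InvImage.trichotomous (r := lt) Subtype.val_injective).1

theorem wordLt_eq_invImage :
    wordLt lt d = InvImage (Prod.Lex (List.Shortlex (pairLt lt d))
        (List.Shortlex fun g h : {h : H // h ≠ 1} => lt g.1 h.1))
      (fun u => ((split u.toList).2.reverse, (split u.toList).1)) := by
  ext u v
  simp [wordLt, InvImage, Prod.lex_def]

instance isWellOrder_wordLt [IsWellOrder H lt] :
    IsWellOrder (FreeMonoid (Letter H)) (wordLt lt d) := by
  rw [wordLt_eq_invImage]
  exact
    { wf := InvImage.wf _ IsWellFounded.wf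
      trichotomous := (InvImage.trichotomous fun u v e => by
        simp only [Prod.mk.injEq, List.reverse_inj] at e
        exact FreeMonoid.toList.injective (split_injective (Prod.ext e.2 e.1))).1 }

/-- `u` stays below `w` in every context. -/
def CtxLt (u w : FreeMonoid (Letter H)) : Prop :=
  ∀ a b, wordLt lt d (a * u * b) (a * w * b)

variable {lt d}

theorem CtxLt.toWordLt {u w : FreeMonoid (Letter H)} (h : CtxLt lt d u w) : wordLt lt d u w := by
  simpa using h 1 1

theorem CtxLt.mul {u w : FreeMonoid (Letter H)} (h : CtxLt lt d u w)
    (a b : FreeMonoid (Letter H)) : CtxLt lt d (a * u * b) (a * w * b) := fun c e => by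
  simpa only [mul_assoc] using h (c * a) (b * e)

theorem CtxLt.mul_left {u w : FreeMonoid (Letter H)} (h : CtxLt lt d u w)
    (a : FreeMonoid (Letter H)) : CtxLt lt d (a * u) (a * w) := by
  simpa using h.mul a 1

theorem CtxLt.mul_right {u w : FreeMonoid (Letter H)} (h : CtxLt lt d u w)
    (b : FreeMonoid (Letter H)) : CtxLt lt d (u * b) (w * b) := by
  simpa using h.mul 1 b

theorem ctxLt_of_stableCount_lt {u w : FreeMonoid (Letter H)}
    (h : stableCount u < stableCount w) : CtxLt lt d u w := by
  intro a b
  refine .inl (.of_length_lt ?_)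
  rw [List.length_reverse, List.length_reverse]
  change stableCount _ < stableCount _
  simpa using h

/-- Comparison runs from the right, so this pair decides and the prefixes matter only through their
number of stable letters. The tail `z` stands for the base letters with which a right context may
begin. -/
theorem ctxLt_of_shortlex {p q : FreeMonoid (Letter H)} {ε : ℤˣ} {x y : List {h : H // h ≠ 1}}
    (hpq : stableCount p = stableCount q)
    (hxy : ∀ z, List.Shortlex (cosetLt lt d ε) (x ++ z) (y ++ z)) :
    CtxLt lt d (p * tWord ε * baseWord x) (q * tWord ε * baseWord y) := by
  intro a b
  have key : ∀ (p : FreeMonoid (Letter H)) x, split (a * (p * tWord ε * baseWord x) * b).toList =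
      ((split (a * p).toList).1, (split (a * p).toList).2 ++
        (ε, x ++ (split b.toList).1) :: (split b.toList).2) := by
    intro p x
    have : (a * (p * tWord ε * baseWord x) * b).toList =
        (a * p).toList ++ .stable ε :: (x.map .base ++ b.toList) := by
      simp [tWord, baseWord]
    rw [this, split_append_stable, split_map_base_append]
  left
  rw [key, key]
  simp only [List.reverse_append, List.reverse_cons, List.append_assoc]
  refine List.Shortlex.append_left (List.Shortlex.of_lex ?_ (.rel (.inr ⟨rfl, hxy _⟩))) _
  rw [stableCount, stableCount] at hpq
  simp [FreeMonoid.toList_mul, length_split_append, hpq]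

/-- A left context decides which letter order applies to the segment; a difference in length counts
in all of them. -/
theorem ctxLt_baseWord {x y : List {h : H // h ≠ 1}} (h : x.length < y.length) :
    CtxLt lt d (baseWord x) (baseWord y) := by
  intro a b
  rcases eq_map_base_or_eq_append_stable a.toList with ⟨z, hz⟩ | ⟨l, ε, z, hz⟩
  · have key : ∀ x, split (a * baseWord x * b).toList =
        (z ++ x ++ (split b.toList).1, (split b.toList).2) := by
      intro x
      rw [← split_map_base_append]
      simp [baseWord, hz]
    right
    rw [key, key]
    exact ⟨rfl, .of_length_lt (by simp; omega)⟩
  · have key : ∀ x, a * baseWord x = FreeMonoid.ofList l * tWord ε * baseWord (z ++ x) := by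
      intro x
      apply FreeMonoid.toList.injective
      simp [baseWord, hz, tWord]
    rw [key, key]
    have := ctxLt_of_shortlex (lt := lt) (d := d) (p := .ofList l) (q := .ofList l) (ε := ε)
      (x := z ++ x) (y := z ++ y) rfl fun c => .of_length_lt (by simp; omega)
    simpa using this 1 b

end Order

end HNNGSB

/-! ### Leading words of binomials -/

namespace GroebnerShirshov

variable {k X : Type*} [Field k] {lt : FreeMonoid X → FreeMonoid X → Prop}

theorem mono_mul (u v : FreeMonoid X) : mono k (u * v) = mono k u * mono k v := by
  simp [mono, MonoidAlgebra.single_mul_single]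

theorem mono_one : mono k (1 : FreeMonoid X) = 1 := rfl

theorem mono_mul_sub_mul (a u v b : FreeMonoid X) :
    mono k a * (mono k u - mono k v) * mono k b = mono k (a * u * b) - mono k (a * v * b) := by
  simp only [mono_mul, mul_sub, sub_mul]

theorem coeff_mono (u v : FreeMonoid X) [Decidable (u = v)] :
    (mono k u).coeff v = if u = v then 1 else 0 := by
  classical
  simp [mono, MonoidAlgebra.coeff_single, Finsupp.single_apply]

theorem coeff_mono_sub_mono {u v : FreeMonoid X} (h : v ≠ u) :
    (mono k u - mono k v).coeff u = 1 := by
  classical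
  simp [coeff_mono, h]

theorem isLeadingWord_mono_sub_mono [IsWellOrder (FreeMonoid X) lt] {u v : FreeMonoid X}
    (h : lt v u) : IsLeadingWord lt (mono k u - mono k v) u := by
  classical
  have hne : v ≠ u := by
    rintro rfl
    exact irrefl_of lt v h
  refine ⟨by rw [coeff_mono_sub_mono hne]; exact one_ne_zero, fun w hw hwu => ?_⟩
  by_cases hvw : v = w
  · exact hvw ▸ h
  · simp [coeff_mono, hvw, hwu.symm] at hw

theorem IsLeadingWord.unique [IsWellOrder (FreeMonoid X) lt] {f : FreeAlg k X}
    {u v : FreeMonoid X} (hu : IsLeadingWord lt f u) (hv : IsLeadingWord lt f v) : u = v := by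
  by_contra h
  exact asymm_of lt (hu.2 v hv.1 (Ne.symm h)) (hv.2 u hu.1 h)

end GroebnerShirshov

/-! ### The rewriting rules -/

namespace HNNGSB

open GroebnerShirshov HNNExtension HNNExtension.NormalWord

variable {H : Type*} [Group H] {A B : Subgroup H}

/-- The rewriting rules behind the Gröbner–Shirshov basis: `Rule φ d x y v` says that the two-letter
word `xy` is rewritten to `v`. -/
inductive Rule (φ : A ≃* B) (d : TransversalPair H B A) :
    Letter H → Letter H → FreeMonoid (Letter H) → Prop
  | mul (g h : {h : H // h ≠ 1}) : Rule φ d (.base g) (.base h) (hWord (g.1 * h.1))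
  | push (ε : ℤˣ) (c : toSubgroup B A ε) (r : H) (g : {h : H // h ≠ 1}) (hc : c ≠ 1)
      (hr : r ∈ d.set ε) (hg : g.1 = c * r) :
      Rule φ d (.stable ε) (.base g)
        (hWord (toSubgroupEquiv φ.symm ε c : H) * tWord ε * hWord r)
  | cancel (ε : ℤˣ) : Rule φ d (.stable ε) (.stable (-ε)) 1

theorem eq_and_eq_of_mul_eq_mul (d : TransversalPair H B A) {ε : ℤˣ} {c c' : toSubgroup B A ε}
    {r r' : H} (hr : r ∈ d.set ε) (hr' : r' ∈ d.set ε) (h : (c : H) * r = c' * r') :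
    c = c' ∧ r = r' := by
  have := (d.compl ε).1 (a₁ := (c, ⟨r, hr⟩)) (a₂ := (c', ⟨r', hr'⟩)) h
  simpa using this

theorem exists_eq_mul (d : TransversalPair H B A) (ε : ℤˣ) (h : H) :
    ∃ (c : toSubgroup B A ε) (r : H), r ∈ d.set ε ∧ h = c * r := by
  obtain ⟨⟨c, r⟩, hcr⟩ := (d.compl ε).2 h
  exact ⟨c, r, r.2, hcr.symm⟩

/-- Otherwise 1 would factor both as `c * r` and as `1 * 1`. Hence `hWord (c * r)` is a single
letter and the push rules have two-letter left sides. -/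
theorem mul_ne_one (d : TransversalPair H B A) {ε : ℤˣ} (hd : 1 ∈ d.set ε)
    {c : toSubgroup B A ε} (hc : c ≠ 1) {r : H} (hr : r ∈ d.set ε) : (c : H) * r ≠ 1 := by
  intro h
  exact hc (eq_and_eq_of_mul_eq_mul d (c' := 1) hr hd (by simpa using h)).1

theorem mul_notMem_set (d : TransversalPair H B A) {ε : ℤˣ}
    {c : toSubgroup B A ε} (hc : c ≠ 1) {r : H} (hr : r ∈ d.set ε) : (c : H) * r ∉ d.set ε := by
  intro h
  exact hc (eq_and_eq_of_mul_eq_mul d (c' := 1) hr h (by simp)).1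

theorem Rule.mul_of_ne_one (φ : A ≃* B) (d : TransversalPair H B A) {g h : H} (hg : g ≠ 1)
    (hh : h ≠ 1) : Rule φ d (.base ⟨g, hg⟩) (.base ⟨h, hh⟩) (hWord (g * h)) :=
  .mul ⟨g, hg⟩ ⟨h, hh⟩

section Relator

variable {k : Type*} [Field k] {φ : A ≃* B} {d : TransversalPair H B A}

theorem mem_basis_iff (hd : ∀ ε, (1 : H) ∈ d.set ε) {f : FreeAlg k (Letter H)} :
    f ∈ basis k φ d ↔
      ∃ x y v, Rule φ d x y v ∧ f = mono k (FreeMonoid.of x * FreeMonoid.of y) - mono k v := by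
  constructor
  · rintro (⟨g, h, hg, hh⟩ | ⟨a, r, ha, hr⟩ | ⟨b, r, hb, hr⟩ | ε)
    · exact ⟨_, _, _, .mul_of_ne_one φ d hg hh, by rw [hWord_of_ne_one hg, hWord_of_ne_one hh]⟩
    · have hne : (a : H) * r ≠ 1 :=
        mul_ne_one (ε := -1) (c := (id a : toSubgroup B A (-1))) d (hd _) ha hr
      refine ⟨_, _, _, .push (-1) a r ⟨_, hne⟩ ha hr rfl, ?_⟩
      rw [hWord_of_ne_one hne]
      rfl
    · have hne : (b : H) * r ≠ 1 := mul_ne_one (ε := 1) (c := b) d (hd _) hb hr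
      refine ⟨_, _, _, .push 1 b r ⟨_, hne⟩ hb hr rfl, ?_⟩
      rw [hWord_of_ne_one hne]
      rfl
    · exact ⟨_, _, _, .cancel ε, rfl⟩
  · rintro ⟨x, y, v, hr, rfl⟩
    cases hr with
    | mul g h =>
      have := Relator.mul (k := k) (φ := φ) (d := d) g.1 h.1 g.2 h.2
      rwa [hWord_of_ne_one g.2, hWord_of_ne_one h.2] at this
    | push ε c r g hc hr hg =>
      rcases Int.units_eq_one_or ε with rfl | rfl
      · have := Relator.pushB (k := k) (φ := φ) (d := d) c r hc hr
        rw [← hg, hWord_of_ne_one g.2] at this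
        exact this
      · have := Relator.pushA (k := k) (φ := φ) (d := d) c r hc hr
        rw [← hg, hWord_of_ne_one g.2] at this
        exact this
    | cancel ε => exact Relator.cancel ε

/-- The factorization `g = c * r` is unique. This makes compositions on identical leading words
vanish. -/
theorem Rule.unique {x y : Letter H} {v v' : FreeMonoid (Letter H)} (h : Rule φ d x y v)
    (h' : Rule φ d x y v') : v = v' := by
  cases h with
  | mul g h => cases h'; rfl
  | push ε c r g hc hr hg =>
    cases h' with
    | push _ c' r' _ hc' hr' hg' =>
      obtain ⟨rfl, rfl⟩ := eq_and_eq_of_mul_eq_mul d hr hr' (hg.symm.trans hg')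
      rfl
  -- Case analysis needs a variable in place of the index `-ε`.
  | cancel ε => generalize hδ : -ε = δ at h'; cases h'; rfl

theorem shortlex_cosetLt (lt : H → H → Prop) {ε : ℤˣ} {r g : H} (hr : r ∈ d.set ε)
    (hg : g ∉ d.set ε) (hr₁ : r ≠ 1) (hg₁ : g ≠ 1) (z : List {h : H // h ≠ 1}) :
    List.Shortlex (cosetLt lt d ε) ([⟨r, hr₁⟩] ++ z) ([⟨g, hg₁⟩] ++ z) :=
  .of_lex rfl (.rel (.inl ⟨hr, hg⟩))

variable {lt : H → H → Prop}

/-- If `r = 1` the segment loses a letter; otherwise `r` precedes `g` because only `r` is a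
representative. The free prefixes `p`, `q` serve both the push rule and the overlap of cancel with
push. -/
theorem ctxLt_push {ε : ℤˣ} {c : toSubgroup B A ε} {r : H} (g : {h : H // h ≠ 1}) (hc : c ≠ 1)
    (hr : r ∈ d.set ε) (hg : g.1 = c * r) {p q : FreeMonoid (Letter H)}
    (hpq : stableCount p = stableCount q) :
    CtxLt lt d (p * tWord ε * hWord r) (q * tWord ε * FreeMonoid.of (.base g)) := by
  have hgn : g.1 ∉ d.set ε := hg ▸ mul_notMem_set d hc hr
  by_cases hr₁ : r = 1
  · subst hr₁
    rw [hWord_one]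
    exact ctxLt_of_shortlex (x := []) (y := [g]) hpq fun z => .of_length_lt (by simp)
  · rw [hWord_of_ne_one hr₁]
    exact ctxLt_of_shortlex (x := [⟨r, hr₁⟩]) (y := [g]) hpq (shortlex_cosetLt lt hr hgn hr₁ g.2)

theorem Rule.ctxLt {x y : Letter H} {v : FreeMonoid (Letter H)}
    (h : Rule φ d x y v) : CtxLt lt d v (FreeMonoid.of x * FreeMonoid.of y) := by
  cases h with
  | mul g h =>
    obtain ⟨x, hx, hl⟩ := exists_hWord_eq_baseWord (g.1 * h.1)
    rw [hx]
    exact ctxLt_baseWord (y := [g, h]) (Nat.lt_succ_of_le hl)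
  | push ε c r g hc hr hg =>
    rw [← one_mul (FreeMonoid.of (Letter.stable ε))]
    exact ctxLt_push g hc hr hg (by simp)
  | cancel ε => exact ctxLt_of_stableCount_lt Nat.two_pos

end Relator

end HNNGSB

namespace HNNGSB

open GroebnerShirshov HNNExtension HNNExtension.NormalWord

variable {H : Type*} [Group H] {A B : Subgroup H}

/-! ### Local confluence -/

section Confluence

variable (k : Type*) [Field k] (φ : A ≃* B) (d : TransversalPair H B A) (lt : H → H → Prop)

/-- The span of the multiples `a s b` of the relators `s` whose leading word stays below `w` in every
context. -/
noncomputable def below (w : FreeMonoid (Letter H)) : Submodule k (FreeAlg k (Letter H)) :=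
  Submodule.span k {p | ∃ x y v a b, Rule φ d x y v ∧
    CtxLt lt d (a * (FreeMonoid.of x * FreeMonoid.of y) * b) w ∧
    p = mono k a * (mono k (FreeMonoid.of x * FreeMonoid.of y) - mono k v) * mono k b}

/-- Two words are congruent below `w` if they differ by a combination of multiples of relators that
stay below `w`. -/
def CongBelow (w u v : FreeMonoid (Letter H)) : Prop :=
  mono k u - mono k v ∈ below k φ d lt w

variable {k φ d lt} {w u v x y z a b : FreeMonoid (Letter H)}

theorem CongBelow.refl (u : FreeMonoid (Letter H)) : CongBelow k φ d lt w u u := by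
  simp [CongBelow]

theorem CongBelow.symm (h : CongBelow k φ d lt w u v) : CongBelow k φ d lt w v u := by
  have := neg_mem h
  rwa [neg_sub] at this

theorem CongBelow.trans (h : CongBelow k φ d lt w x y) (h' : CongBelow k φ d lt w y z) :
    CongBelow k φ d lt w x z := by
  have := add_mem h h'
  rwa [sub_add_sub_cancel] at this

theorem Rule.congBelow {x y : Letter H} (h : Rule φ d x y v)
    (hw : CtxLt lt d (a * (FreeMonoid.of x * FreeMonoid.of y) * b) w) :
    CongBelow k φ d lt w (a * (FreeMonoid.of x * FreeMonoid.of y) * b) (a * v * b) := by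
  rw [CongBelow, ← mono_mul_sub_mul]
  exact Submodule.subset_span ⟨x, y, v, a, b, h, hw, rfl⟩

theorem congBelow_mul (a b : FreeMonoid (Letter H)) {g h : H}
    (hw : CtxLt lt d (a * (hWord g * hWord h) * b) w) :
    CongBelow k φ d lt w (a * (hWord g * hWord h) * b) (a * hWord (g * h) * b) := by
  by_cases hg : g = 1
  · simpa [hg] using .refl _
  by_cases hh : h = 1
  · simpa [hh] using .refl _
  rw [hWord_of_ne_one hg, hWord_of_ne_one hh] at hw ⊢
  exact (Rule.mul_of_ne_one φ d hg hh).congBelow hw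

theorem congBelow_push (hd : ∀ ε, (1 : H) ∈ d.set ε) (a b : FreeMonoid (Letter H)) {ε : ℤˣ}
    {c : toSubgroup B A ε} {r : H} (hr : r ∈ d.set ε)
    (hw : CtxLt lt d (a * (tWord ε * hWord (c * r)) * b) w) :
    CongBelow k φ d lt w (a * (tWord ε * hWord (c * r)) * b)
      (a * (hWord (toSubgroupEquiv φ.symm ε c : H) * tWord ε * hWord r) * b) := by
  by_cases hc : c = 1
  · simpa [hc] using .refl _
  have hne := mul_ne_one d (hd ε) hc hr
  rw [hWord_of_ne_one hne] at hw ⊢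
  exact (Rule.push ε c r ⟨_, hne⟩ hc hr rfl).congBelow hw

theorem congBelow_cancel (a b : FreeMonoid (Letter H)) (ε : ℤˣ)
    (hw : CtxLt lt d (a * (tWord ε * tWord (-ε)) * b) w) :
    CongBelow k φ d lt w (a * (tWord ε * tWord (-ε)) * b) (a * b) := by
  have := (Rule.cancel ε).congBelow (k := k) (φ := φ) hw
  rwa [mul_one] at this

/-- The rewriting rules are locally confluent. -/
theorem Rule.confluent (hd : ∀ ε, (1 : H) ∈ d.set ε) {x y z : Letter H}
    (h : Rule φ d x y u) (h' : Rule φ d y z v) :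
    CongBelow k φ d lt (FreeMonoid.of x * FreeMonoid.of y * FreeMonoid.of z)
      (u * FreeMonoid.of z) (FreeMonoid.of x * v) := by
  have hu := (h.ctxLt (lt := lt)).mul_right (FreeMonoid.of z)
  have hv := (h'.ctxLt (lt := lt)).mul_left (FreeMonoid.of x)
  rw [← mul_assoc] at hv
  cases h with
  | mul g h =>
    cases h' with
    | mul _ l =>
      simp only [← hWord_of_ne_one g.2, ← hWord_of_ne_one l.2, ← hWord_of_ne_one h.2] at hu hv ⊢
      have h₁ := congBelow_mul (k := k) (φ := φ) 1 1 (by simpa using hu)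
      have h₂ := congBelow_mul (k := k) (φ := φ) 1 1 (by simpa using hv)
      simp only [one_mul, mul_one] at h₁ h₂
      rw [mul_assoc g.1] at h₁
      exact h₁.trans h₂.symm
  | push ε c r g hc hr hg =>
    cases h' with
    | mul _ l =>
      -- With `c'` for the image of `c`, the two reductions meet in `(c c₂)' t^ε r₂`: one goes `t^ε
      -- (c r) l → c' t^ε r l → c' t^ε (c₂ r₂) → c' c₂' t^ε r₂`, the other multiplies `g l = c c₂
      -- r₂` first.
      obtain ⟨c₂, r₂, hr₂, h₂⟩ := exists_eq_mul d ε (r * l.1)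
      have hgl : g.1 * l.1 = ((c * c₂ : toSubgroup B A ε) : H) * r₂ := by
        rw [hg, mul_assoc, h₂, Subgroup.coe_mul, mul_assoc]
      -- The last segment `s` has at most one letter, against the two letters `g`, `l`.
      have key : ∀ (p : FreeMonoid (Letter H)) (s : H), stableCount p = 0 →
          CtxLt lt d (p * tWord ε * hWord s) (tWord ε * hWord g.1 * hWord l.1) := by
        intro p s hp
        obtain ⟨xs, hxs, hl⟩ := exists_hWord_eq_baseWord s
        have := ctxLt_of_shortlex (lt := lt) (d := d) (p := p) (q := 1) (ε := ε) (x := xs)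
          (y := [g, l]) hp fun z => .of_length_lt (by simp; omega)
        rw [hxs, hWord_of_ne_one g.2, hWord_of_ne_one l.2, mul_assoc (tWord ε)]
        exact this
      simp only [← hWord_of_ne_one g.2, ← hWord_of_ne_one l.2] at hu hv ⊢
      change CtxLt lt d _ (tWord ε * _ * _) at hu hv
      change CongBelow k φ d lt (tWord ε * _ * _) _ (tWord ε * _)
      rw [mul_assoc] at hu ⊢
      have e₁ := congBelow_mul (k := k) (φ := φ) (hWord (toSubgroupEquiv φ.symm ε c : H) * tWord ε) 1
        (by simpa using hu)
      have e₂ := congBelow_push (k := k) (φ := φ) hd (hWord (toSubgroupEquiv φ.symm ε c : H)) 1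
        (ε := ε) (c := c₂) hr₂ (by
          rw [← h₂, mul_one, ← mul_assoc]
          exact key _ _ (by simp))
      have e₃ := congBelow_mul (k := k) (φ := φ) (w := tWord ε * hWord g.1 * hWord l.1) (lt := lt)
        (d := d) 1 (tWord ε * hWord r₂)
        (g := (toSubgroupEquiv φ.symm ε c : H)) (h := (toSubgroupEquiv φ.symm ε c₂ : H)) (by
          rw [← mul_assoc]
          exact key _ _ (by simp))
      have e₄ := congBelow_push (k := k) (φ := φ) hd 1 1 (ε := ε) (c := c * c₂) hr₂ (by
          rw [← hgl, one_mul, mul_one]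
          exact hv)
      rw [← h₂] at e₂
      rw [← hgl] at e₄
      simp only [one_mul, mul_one, map_mul, Subgroup.coe_mul, mul_assoc] at e₁ e₂ e₃ e₄ ⊢
      exact (e₁.trans e₂).trans (e₃.trans e₄.symm)
  | cancel ε =>
    generalize hδ : -ε = δ at *
    obtain rfl : ε = -δ := by rw [← hδ, neg_neg]
    cases h' with
    | push _ c r g hc hr hg =>
      simp only [one_mul] at hu ⊢
      change CtxLt lt d (tWord (-δ) * _) (tWord (-δ) * tWord δ * _) at hv
      change CongBelow k φ d lt (tWord (-δ) * tWord δ * _) _ (tWord (-δ) * _)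
      set w := tWord (-δ) * tWord δ * FreeMonoid.of (Letter.base g)
      set c' := toSubgroupEquiv φ.symm δ c
      have hcc : (toSubgroupEquiv φ.symm (-δ) c' : H) = c := toSubgroupEquiv_neg_apply _ _ _
      -- Here `c'` is pushed back through `t^(-δ)` with representative 1: `t^(-δ) c' t^δ r → c
      -- t^(-δ) t^δ r → c r → g`. The middle word is below `w` although it has an extra letter `c`,
      -- since `r` replaces `g` at the right end.
      have e₁ := congBelow_push (k := k) (φ := φ) (w := w) (lt := lt) hd 1 (tWord δ * hWord r)
        (c := c') (hd (-δ)) (by simpa [mul_assoc] using hv)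
      have e₂ := congBelow_cancel (k := k) (φ := φ) (d := d) (lt := lt) (w := w) (hWord c.1)
        (hWord r) (-δ) (by
          rw [neg_neg, ← mul_assoc]
          exact ctxLt_push g hc hr hg (by simp))
      have e₃ := congBelow_mul (k := k) (φ := φ) (d := d) (lt := lt) (w := w) 1 1
        (g := c.1) (h := r) (ctxLt_of_stableCount_lt (by simp [w]))
      rw [hcc] at e₁
      rw [neg_neg] at e₂
      rw [← hg, hWord_of_ne_one g.2] at e₃
      simp only [one_mul, mul_one, mul_assoc, hWord_one] at e₁ e₂ e₃ ⊢
      exact (e₁.trans (e₂.trans e₃)).symm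
    | cancel _ => simpa [neg_neg] using .refl _

end Confluence

end HNNGSB

namespace HNNGSB

open GroebnerShirshov HNNExtension HNNExtension.NormalWord

variable {H : Type*} [Group H] {A B : Subgroup H}

/-! ### Compositions and the Gröbner–Shirshov property -/

section Compositions

variable {k : Type*} [Field k] {φ : A ≃* B} {d : TransversalPair H B A} {lt : H → H → Prop}
  [IsWellOrder H lt]

theorem Rule.isLeadingWord {x y : Letter H} {v : FreeMonoid (Letter H)} (h : Rule φ d x y v) :
    IsLeadingWord (wordLt lt d) (mono k (FreeMonoid.of x * FreeMonoid.of y) - mono k v)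
      (FreeMonoid.of x * FreeMonoid.of y) :=
  isLeadingWord_mono_sub_mono h.ctxLt.toWordLt

theorem Rule.isLeadingWord_mul {x y : Letter H} {v : FreeMonoid (Letter H)}
    (h : Rule φ d x y v) (a b : FreeMonoid (Letter H)) :
    IsLeadingWord (wordLt lt d)
      (mono k a * (mono k (FreeMonoid.of x * FreeMonoid.of y) - mono k v) * mono k b)
      (a * (FreeMonoid.of x * FreeMonoid.of y) * b) := by
  rw [mono_mul_sub_mul]
  exact isLeadingWord_mono_sub_mono (h.ctxLt a b)

theorem overlap_of_mul_eq_mul {X : Type*} {x y y' z : X} {a b : FreeMonoid X}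
    (h : FreeMonoid.of x * FreeMonoid.of y * b = a * (FreeMonoid.of y' * FreeMonoid.of z))
    (hb : b.length ≤ 1) :
    (a = 1 ∧ b = 1 ∧ x = y' ∧ y = z) ∨ (a = FreeMonoid.of x ∧ b = FreeMonoid.of z ∧ y = y') := by
  have hl := congrArg FreeMonoid.toList h
  simp only [FreeMonoid.toList_mul, FreeMonoid.toList_of] at hl
  change b.toList.length ≤ 1 at hb
  change (a.toList = [] ∧ b.toList = [] ∧ _) ∨ (a.toList = [x] ∧ b.toList = [z] ∧ _)
  generalize a.toList = a, b.toList = b at hl hb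
  rcases b with _ | ⟨b₀, _ | ⟨b₁, b⟩⟩
  · rcases a with _ | ⟨a₀, a⟩
    · simpa using hl
    · exact absurd (congrArg List.length hl) (by simp)
  · rcases a with _ | ⟨a₀, _ | ⟨a₁, a⟩⟩
    · exact absurd (congrArg List.length hl) (by simp)
    · have hl : x = a₀ ∧ y = y' ∧ b₀ = z := by simpa using hl
      simp [hl]
    · exact absurd (congrArg List.length hl) (by simp)
  · simp at hb

theorem composition_mem_below (hd : ∀ ε, (1 : H) ∈ d.set ε) {f g p : FreeAlg k (Letter H)}
    {w : FreeMonoid (Letter H)} (hf : f ∈ basis k φ d) (hg : g ∈ basis k φ d)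
    (h : IsComposition (wordLt lt d) f g w p) : p ∈ below k φ d lt w := by
  obtain ⟨x, y, v, hxy, rfl⟩ := (mem_basis_iff hd).1 hf
  obtain ⟨y', z, v', hyz, rfl⟩ := (mem_basis_iff hd).1 hg
  cases h with
  | intersection u₁ u₂ a b h₁ h₂ hl hr hdeg =>
    obtain rfl := h₁.unique hxy.isLeadingWord
    obtain rfl := h₂.unique hyz.isLeadingWord
    subst hl
    -- The degree condition reads `2 + |b| < 2 + 2`.
    have hb : b.length ≤ 1 := by
      simp only [FreeMonoid.length_mul, FreeMonoid.length_of] at hdeg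
      omega
    rcases overlap_of_mul_eq_mul hr hb with ⟨rfl, rfl, rfl, rfl⟩ | ⟨rfl, rfl, rfl⟩
    · rw [hxy.unique hyz]
      simp [mono_one]
    · have := (hxy.confluent (k := k) (lt := lt) hd hyz).symm
      rw [CongBelow] at this
      convert this using 1
      simp only [mono_mul, mul_sub, sub_mul, mul_assoc]
      abel
  | inclusion u a b h₁ h₂ hw =>
    obtain rfl := h₁.unique hxy.isLeadingWord
    obtain rfl := h₂.unique hyz.isLeadingWord
    have hl := congrArg FreeMonoid.length hw
    simp only [FreeMonoid.length_mul, FreeMonoid.length_of] at hl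
    obtain rfl : b = 1 := FreeMonoid.length_eq_zero.1 (by omega)
    -- An inclusion of words of equal length is an overlap with trivial `b`, which forces the two
    -- words to coincide.
    rw [← mul_one (FreeMonoid.of x * FreeMonoid.of y), mul_one (a * _)] at hw
    rcases overlap_of_mul_eq_mul hw (by simp) with ⟨rfl, -, rfl, rfl⟩ | ⟨-, hb, -⟩
    · rw [hxy.unique hyz]
      simp [mono_one]
    · exact absurd hb.symm (FreeMonoid.of_ne_one _)

theorem exists_sum_of_mem_below (hd : ∀ ε, (1 : H) ∈ d.set ε) {w : FreeMonoid (Letter H)}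
    {p : FreeAlg k (Letter H)} (hp : p ∈ below k φ d lt w) :
    ∃ (n : ℕ) (α : Fin n → k) (a b : Fin n → FreeMonoid (Letter H))
      (s : Fin n → FreeAlg k (Letter H)) (u : Fin n → FreeMonoid (Letter H)),
      p = ∑ i, α i • (mono k (a i) * s i * mono k (b i)) ∧
      ∀ i, s i ∈ basis k φ d ∧ IsLeadingWord (wordLt lt d) (s i) (u i) ∧
        CtxLt lt d (a i * u i * b i) w := by
  obtain ⟨n, α, g, rfl⟩ := Submodule.mem_span_set'.1 hp
  choose x y v a b hr hw hg using fun i => (g i).2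
  refine ⟨n, α, a, b, fun i => mono k (FreeMonoid.of (x i) * FreeMonoid.of (y i)) - mono k (v i),
    fun i => FreeMonoid.of (x i) * FreeMonoid.of (y i), Finset.sum_congr rfl fun i _ => ?_,
    fun i => ⟨(mem_basis_iff hd).2 ⟨_, _, _, hr i, rfl⟩, (hr i).isLeadingWord, hw i⟩⟩
  rw [hg i]

theorem isWeakMonomialOrder (hd : ∀ ε, (1 : H) ∈ d.set ε) :
    IsWeakMonomialOrder (wordLt lt d) (basis k φ d) := by
  refine ⟨inferInstance, fun s hs u hu a b => ?_, fun f hf g hg w p h => ?_⟩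
  · obtain ⟨x, y, v, hr, rfl⟩ := (mem_basis_iff hd).1 hs
    obtain rfl := hu.unique hr.isLeadingWord
    exact hr.isLeadingWord_mul a b
  · obtain ⟨n, α, a, b, s, u, hp, hs⟩ :=
      exists_sum_of_mem_below hd (composition_mem_below hd hf hg h)
    exact ⟨n, α, a, b, s, u, hp, fun i =>
      ⟨(hs i).1, (hs i).2.1, (hs i).2.2.toWordLt, (hs i).2.2⟩⟩

theorem isGSBasis (hd : ∀ ε, (1 : H) ∈ d.set ε) :
    IsGSBasis (wordLt lt d) (basis k φ d) := by
  have hweak := isWeakMonomialOrder (k := k) (φ := φ) (lt := lt) hd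
  refine ⟨inferInstance, fun s hs => ?_, fun f hf g hg w p h => ?_⟩
  · obtain ⟨x, y, v, hr, rfl⟩ := (mem_basis_iff hd).1 hs
    refine ⟨_, hr.isLeadingWord, coeff_mono_sub_mono fun hv => ?_⟩
    have := (hr.ctxLt (lt := lt)).toWordLt
    rw [hv] at this
    exact irrefl_of _ _ this
  · obtain ⟨n, α, a, b, s, u, hp, h⟩ := hweak.2.2 f hf g hg w p h
    exact ⟨n, α, a, b, s, hp, fun i =>
      ⟨(h i).1, _, hweak.2.1 _ (h i).1 _ (h i).2.1 _ _, (h i).2.2.1⟩⟩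

end Compositions

/-! ### Irreducible words and normal forms -/

section NormalForms

variable {k : Type*} [Field k] {φ : A ≃* B} {d : TransversalPair H B A}

/-- No rewriting rule applies to the two-letter word `xy`. -/
def NoRule (φ : A ≃* B) (d : TransversalPair H B A) (x y : Letter H) : Prop :=
  ∀ v, ¬ Rule φ d x y v

theorem noRule_base_base (g h : {h : H // h ≠ 1}) : ¬ NoRule φ d (.base g) (.base h) :=
  fun hn => hn _ (.mul g h)

theorem noRule_base_stable (g : {h : H // h ≠ 1}) (ε : ℤˣ) :
    NoRule φ d (.base g) (.stable ε) := by
  rintro v ⟨⟩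

theorem noRule_stable_base {ε : ℤˣ} {g : {h : H // h ≠ 1}} :
    NoRule φ d (.stable ε) (.base g) ↔ g.1 ∈ d.set ε := by
  constructor
  · intro hn
    obtain ⟨c, r, hr, hg⟩ := exists_eq_mul d ε g.1
    by_cases hc : c = 1
    · rw [hg, hc]
      simpa using hr
    · exact absurd (.push ε c r g hc hr hg) (hn _)
  · rintro hg _ ⟨⟩
    rename_i c r hc hr hcr
    exact mul_notMem_set d hc hr (hcr ▸ hg)

theorem noRule_stable_stable {ε δ : ℤˣ} : NoRule φ d (.stable ε) (.stable δ) ↔ ε = δ := by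
  constructor
  · intro hn
    by_contra h
    obtain rfl : δ = -ε := Int.units_ne_iff_eq_neg.1 (Ne.symm h)
    exact hn _ (.cancel ε)
  · rintro rfl v h
    -- Free letters `x`, `y` avoid having to unify `ε` with `-ε` in the cancel case.
    have key : ∀ x y, Rule φ d x y v → x = .stable ε → y ≠ .stable ε := by
      rintro _ _ (_ | _ | δ) hx hy
      · simp at hx
      · simp at hy
      · simp only [Letter.stable.injEq] at hx hy
        exact units_ne_neg_self ε (hy.symm.trans (congrArg _ hx))
    exact key _ _ h rfl rfl

/-- All leading words have two letters, so only adjacent letters have to be inspected. -/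
theorem mem_irr_iff (hd : ∀ ε, (1 : H) ∈ d.set ε) {lt : H → H → Prop} [IsWellOrder H lt]
    {w : FreeMonoid (Letter H)} :
    w ∈ Irr (wordLt lt d) (basis k φ d) ↔ w.toList.IsChain (NoRule φ d) := by
  rw [List.isChain_iff_forall_rel_of_append_cons_cons]
  constructor
  · intro hw x y a b hab v hr
    refine hw _ ((mem_basis_iff hd).2 ⟨x, y, v, hr, rfl⟩) _ hr.isLeadingWord (.ofList a) (.ofList b) ?_
    apply FreeMonoid.toList.injective
    simp [hab]
  · rintro hw s hs u hu a b rfl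
    obtain ⟨x, y, v, hr, rfl⟩ := (mem_basis_iff hd).1 hs
    obtain rfl := hu.unique hr.isLeadingWord
    exact hw (l₁ := a.toList) (l₂ := b.toList) (by simp) v hr

@[simp]
theorem spell_ofGroup (g : H) : spell (ofGroup g : NormalWord d) = hWord g := by
  simp [spell]

@[simp]
theorem spell_cons (g : H) (u : ℤˣ) (w : NormalWord d) (h₁ h₂) :
    spell (cons g u w h₁ h₂) = hWord g * (tWord u * spell w) := by
  simp [spell, mul_assoc]

theorem isChain_toList_hWord_mul {g : H} {w : FreeMonoid (Letter H)}
    (h : w.toList.IsChain (NoRule φ d)) (hw : ∀ x ∈ w.toList.head?, ∃ ε, x = .stable ε) :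
    (hWord g * w).toList.IsChain (NoRule φ d) := by
  by_cases hg : g = 1
  · simpa [hg] using h
  · rw [hWord_of_ne_one hg]
    refine List.isChain_cons.2 ⟨fun x hx => ?_, h⟩
    obtain ⟨ε, rfl⟩ := hw x hx
    exact noRule_base_stable _ _

theorem head?_toList_spell (w : NormalWord d) (hw : w.head = 1) :
    (spell w).toList.head? = (w.toList.head?.map Prod.fst).map .stable := by
  cases w using consRecOn with
  | ofGroup g =>
    obtain rfl : g = 1 := hw
    simp
  | cons g u w h₁ h₂ =>
    obtain rfl : g = 1 := hw
    simp [tWord]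

theorem isChain_toList_spell (w : NormalWord d) :
    (spell w).toList.IsChain (NoRule φ d) := by
  induction w using consRecOn with
  | ofGroup g =>
    have := isChain_toList_hWord_mul (φ := φ) (d := d) (g := g) (w := 1) (by simp) (by simp)
    simpa using this
  | cons g u w h₁ h₂ ih =>
    rw [spell_cons]
    refine isChain_toList_hWord_mul (List.isChain_cons.2 ⟨fun x hx => ?_, ih⟩) (by simp [tWord])
    by_cases hw : w.head = 1
    · change x ∈ (spell w).toList.head? at hx
      rw [head?_toList_spell w hw, Option.mem_def, Option.map_eq_some_iff] at hx
      obtain ⟨δ, hδ, rfl⟩ := hx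
      exact noRule_stable_stable.2 (h₂ δ hδ (hw ▸ one_mem _))
    · change x ∈ (spell w).toList.head? at hx
      rw [spell, hWord_of_ne_one hw] at hx
      obtain rfl : Letter.base ⟨w.head, hw⟩ = x := by simpa using hx
      exact noRule_stable_base.2 h₁

/-- The normal form is built from the right: a base letter multiplies the head, which is 1 since two
base letters are never adjacent, and a stable letter opens a new pair. -/
theorem exists_spell_eq (hd : ∀ ε, (1 : H) ∈ d.set ε) (l : List (Letter H))
    (h : l.IsChain (NoRule φ d)) : ∃ w : NormalWord d, (spell w).toList = l := by
  induction l with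
  | nil => exact ⟨ofGroup 1, by simp⟩
  | cons x l ih =>
    rw [List.isChain_cons] at h
    obtain ⟨w, rfl⟩ := ih h.2
    have hbase : ∀ hw : w.head ≠ 1, NoRule φ d x (.base ⟨w.head, hw⟩) := fun hw => by
      refine h.1 _ ?_
      rw [spell, hWord_of_ne_one hw]
      simp
    cases x with
    | base g =>
      have hw : w.head = 1 := by
        by_contra hw
        exact noRule_base_base _ _ (hbase hw)
      refine ⟨g.1 • w, ?_⟩
      simp [spell, hw, hWord_of_ne_one g.2]
    | stable ε =>
      have hset : w.head ∈ d.set ε := by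
        by_cases hw : w.head = 1
        · exact hw ▸ hd ε
        · exact noRule_stable_base.1 (hbase hw)
      refine ⟨cons 1 ε w hset fun δ hδ hw => ?_, by rw [spell_cons]; simp [tWord]⟩
      -- A representative lying in the subgroup represents the coset of 1, hence is 1. So the two
      -- stable letters are adjacent in the spelled word.
      have hw₁ : w.head = 1 := by
        by_contra hw₁
        exact mul_notMem_set d (c := ⟨w.head, hw⟩) (fun h => hw₁ (congrArg Subtype.val h)) (hd ε)
          (by simpa using hset)
      refine noRule_stable_stable.1 (h.1 (.stable δ) ?_)
      rw [head?_toList_spell w hw₁]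
      simpa using hδ

theorem irr_eq_range_spell (hd : ∀ ε, (1 : H) ∈ d.set ε) (lt : H → H → Prop) [IsWellOrder H lt] :
    Irr (wordLt lt d) (basis k φ d) = Set.range (spell : NormalWord d → FreeMonoid (Letter H)) := by
  ext w
  rw [mem_irr_iff hd]
  constructor
  · intro hw
    obtain ⟨n, hn⟩ := exists_spell_eq hd _ hw
    exact ⟨n, FreeMonoid.toList.injective hn⟩
  · rintro ⟨n, rfl⟩
    exact isChain_toList_spell n

@[simp]
theorem eval_hWord (g : H) : eval φ (hWord g) = of g := by
  by_cases hg : g = 1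
  · simp [hg]
  · simp [hWord_of_ne_one hg, eval]

@[simp]
theorem eval_tWord (ε : ℤˣ) : eval φ (tWord ε) = t ^ (ε : ℤ) := by
  simp [tWord, eval]

theorem eval_spell (w : NormalWord d) :
    eval φ (spell w) = w.toReducedWord.prod φ.symm := by
  simp [spell, ReducedWord.prod, map_list_prod, Function.comp_def]

theorem eval_spell_equiv (g : HNN φ) :
    eval φ (spell (NormalWord.equiv φ.symm d g)) = g := by
  rw [eval_spell]
  exact (NormalWord.equiv φ.symm d).symm_apply_apply g

theorem bijOn_eval_irr (hd : ∀ ε, (1 : H) ∈ d.set ε) (lt : H → H → Prop) [IsWellOrder H lt] :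
    Set.BijOn (eval φ) (Irr (wordLt lt d) (basis k φ d)) Set.univ := by
  rw [irr_eq_range_spell hd]
  refine ⟨fun _ _ => trivial, ?_, fun g _ => ?_⟩
  · rintro _ ⟨w, rfl⟩ _ ⟨w', rfl⟩ h
    rw [eval_spell, eval_spell] at h
    rw [prod_injective φ.symm d h]
  · exact ⟨_, ⟨NormalWord.equiv φ.symm d g, rfl⟩, eval_spell_equiv g⟩

theorem eval_eq_of_rule {x y : Letter H} {v : FreeMonoid (Letter H)} (h : Rule φ d x y v) :
    eval φ (FreeMonoid.of x * FreeMonoid.of y) = eval φ v := by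
  cases h with
  | mul g h =>
    rw [← hWord_of_ne_one g.2, ← hWord_of_ne_one h.2]
    simp
  | push ε c r g hc hr hg =>
    rw [← hWord_of_ne_one g.2, hg]
    change eval φ (tWord ε * _) = _
    simp only [map_mul, eval_hWord, eval_tWord, ← mul_assoc]
    congr 1
    rcases Int.units_eq_one_or ε with rfl | rfl
    · rw [Units.val_one, zpow_one]
      exact t_mul_of (φ := φ.symm) c
    · rw [Units.val_neg, Units.val_one, zpow_neg, zpow_one]
      exact inv_t_mul_of (φ := φ.symm) c
  | cancel ε =>
    change eval φ (tWord ε * tWord (-ε)) = _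
    simp

end NormalForms

/-! ### The kernel of the map to the group algebra -/

section Kernel

variable {k : Type*} [Field k] {φ : A ≃* B} {d : TransversalPair H B A}

theorem evalAlg_mono (w : FreeMonoid (Letter H)) :
    evalAlg k φ (mono k w) = MonoidAlgebra.single (eval φ w) 1 := by
  simp [evalAlg, mono]

/-- Each rewriting step lowers the word, and the order is well-founded. -/
theorem exists_irr_congruent (hd : ∀ ε, (1 : H) ∈ d.set ε) (lt : H → H → Prop)
    [IsWellOrder H lt] (w : FreeMonoid (Letter H)) :
    ∃ v ∈ Irr (wordLt lt d) (basis k φ d), eval φ w = eval φ v ∧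
      mono k w - mono k v ∈ TwoSidedIdeal.span (basis k φ d) := by
  induction w using (isWellOrder_wordLt lt d).wf.induction with
  | h w ih =>
    by_cases hw : w ∈ Irr (wordLt lt d) (basis k φ d)
    · exact ⟨w, hw, rfl, by simp⟩
    · simp only [Irr, Set.mem_ofPred_eq, not_forall, not_not] at hw
      obtain ⟨s, hs, u, hu, a, b, rfl⟩ := hw
      obtain ⟨x, y, v, hr, rfl⟩ := (mem_basis_iff hd).1 hs
      obtain rfl := hu.unique hr.isLeadingWord
      obtain ⟨v', hv', he, hm⟩ := ih (a * v * b) (hr.ctxLt a b)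
      refine ⟨v', hv', ?_, ?_⟩
      · rw [← he, map_mul, map_mul, eval_eq_of_rule hr, ← map_mul, ← map_mul]
      · rw [← sub_add_sub_cancel _ (mono k (a * v * b))]
        refine TwoSidedIdeal.add_mem _ ?_ hm
        rw [← mono_mul_sub_mul]
        exact TwoSidedIdeal.mul_mem_right _ _ _
          (TwoSidedIdeal.mul_mem_left _ _ _ (TwoSidedIdeal.subset_span hs))

/-- Both words reduce to irreducible words with the same value, which coincide by uniqueness of
normal forms. -/
theorem mono_sub_mono_mem_span (hd : ∀ ε, (1 : H) ∈ d.set ε) {lt : H → H → Prop}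
    [IsWellOrder H lt] {u w : FreeMonoid (Letter H)} (h : eval φ u = eval φ w) :
    mono k u - mono k w ∈ TwoSidedIdeal.span (basis k φ d) := by
  obtain ⟨u', hu', eu, mu⟩ := exists_irr_congruent (k := k) (φ := φ) hd lt u
  obtain ⟨w', hw', ew, mw⟩ := exists_irr_congruent (k := k) (φ := φ) hd lt w
  obtain rfl : u' = w' :=
    (bijOn_eval_irr (k := k) (φ := φ) hd lt).injOn hu' hw' (eu.symm.trans (h.trans ew))
  have := TwoSidedIdeal.sub_mem _ mu mw
  rwa [sub_sub_sub_cancel_right] at this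

theorem eval_surjective : Function.Surjective (eval φ) := by
  obtain ⟨d⟩ := TransversalPair.nonempty H B A
  exact fun g => ⟨_, eval_spell_equiv (d := d) g⟩

theorem evalAlg_surjective : Function.Surjective (evalAlg k φ) := by
  intro f
  induction f using MonoidAlgebra.induction_linear with
  | zero => exact ⟨0, map_zero _⟩
  | add f g hf hg =>
    obtain ⟨u, rfl⟩ := hf
    obtain ⟨v, rfl⟩ := hg
    exact ⟨u + v, map_add _ _ _⟩
  | single g c =>
    obtain ⟨u, rfl⟩ := eval_surjective g
    exact ⟨c • mono k u, by simp [evalAlg_mono]⟩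

theorem ker_evalAlg (hd : ∀ ε, (1 : H) ∈ d.set ε) {lt : H → H → Prop} [IsWellOrder H lt] :
    TwoSidedIdeal.ker (evalAlg k φ) = TwoSidedIdeal.span (basis k φ d) := by
  apply le_antisymm
  · -- `σ` sends a group element to a chosen word that represents it.
    let σ : MonoidAlgebra k (HNN φ) →ₗ[k] FreeAlg k (Letter H) :=
      MonoidAlgebra.mapDomainLinearMap k k (Function.surjInv (eval_surjective (φ := φ)))
    -- Modulo the ideal every `f` is determined by its image; an image of zero then puts `f` in the
    -- ideal.
    have key : ∀ f : FreeAlg k (Letter H),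
        f - σ (evalAlg k φ f) ∈ TwoSidedIdeal.span (basis k φ d) := by
      intro f
      induction f using MonoidAlgebra.induction_linear with
      | zero => simp
      | add f g hf hg =>
        rw [map_add, map_add, add_sub_add_comm]
        exact TwoSidedIdeal.add_mem _ hf hg
      | single w c =>
        have hw : (MonoidAlgebra.single w c : FreeAlg k (Letter H)) = c • mono k w := by
          simp [mono]
        have hσ : σ (evalAlg k φ (mono k w)) =
            mono k (Function.surjInv eval_surjective (eval φ w)) := by
          rw [evalAlg_mono]
          exact MonoidAlgebra.mapDomainLinearMap_single ..
        rw [hw, map_smul, map_smul, hσ, ← smul_sub, Algebra.smul_def]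
        exact TwoSidedIdeal.mul_mem_left _ _ _ (mono_sub_mono_mem_span (lt := lt) hd
          (Function.surjInv_eq eval_surjective _).symm)
    intro f hf
    have := key f
    rwa [(TwoSidedIdeal.mem_ker _).1 hf, map_zero, sub_zero] at this
  · rw [TwoSidedIdeal.span_le]
    intro s hs
    obtain ⟨x, y, v, hr, rfl⟩ := (mem_basis_iff hd).1 hs
    rw [SetLike.mem_coe, TwoSidedIdeal.mem_ker, map_sub, evalAlg_mono, evalAlg_mono,
      eval_eq_of_rule hr, sub_self]

end Kernel

end HNNGSB

/-- Let `G = gp⟨H, t | t⁻¹ a t = φ(a), a ∈ A⟩` be an HNN-extension, `d` a choice of representatives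
of the right cosets of `A` and `B` with `1` among them, and `lt` a well order on `H`.  Then `S` is a
Gröbner–Shirshov basis of `G` (it is one in `k⟨X⟩`, and `k⟨X⟩ / Id(S)` is the group algebra `k[G]`),
the order on words is `S`-weak monomial, and `Irr(S)` is the set of the normal forms, each element
of `G` having exactly one of them. -/
theorem mainTheorem11 {k H : Type*} [Field k] [Group H] {A B : Subgroup H} (φ : A ≃* B)
    (d : HNNExtension.NormalWord.TransversalPair H B A) (hd : ∀ ε, (1 : H) ∈ d.set ε)
    (lt : H → H → Prop) (hlt : IsWellOrder H lt) :
    GroebnerShirshov.IsWeakMonomialOrder (HNNGSB.wordLt lt d) (HNNGSB.basis k φ d) ∧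
    GroebnerShirshov.IsGSBasis (HNNGSB.wordLt lt d) (HNNGSB.basis k φ d) ∧
    (Function.Surjective (HNNGSB.evalAlg k φ) ∧
      TwoSidedIdeal.ker (HNNGSB.evalAlg k φ) = TwoSidedIdeal.span (HNNGSB.basis k φ d)) ∧
    GroebnerShirshov.Irr (HNNGSB.wordLt lt d) (HNNGSB.basis k φ d) =
      Set.range (HNNGSB.spell : HNNExtension.NormalWord d → FreeMonoid (HNNGSB.Letter H)) ∧
    (∀ w : HNNExtension.NormalWord d,
      HNNGSB.eval φ (HNNGSB.spell w) = w.toReducedWord.prod φ.symm) ∧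
    Set.BijOn (HNNGSB.eval φ)
      (GroebnerShirshov.Irr (HNNGSB.wordLt lt d) (HNNGSB.basis k φ d)) Set.univ := by
  have := hlt
  exact ⟨HNNGSB.isWeakMonomialOrder hd, HNNGSB.isGSBasis hd,
    ⟨HNNGSB.evalAlg_surjective, HNNGSB.ker_evalAlg (lt := lt) hd⟩,
    HNNGSB.irr_eq_range_spell hd lt, HNNGSB.eval_spell, HNNGSB.bijOn_eval_irr hd lt⟩
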